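/- Let $d\ge 1$ and let $T=\{T^{\vec v}\}_{\vec v\in\mathbb Z^d}$ be a free measure preserving $\mathbb Z^d$ action on a Lebesgue probability space $(X,\mathcal A,\mu)$. Definitions. A tower of shape $R$ (a finite subset of $\mathbb Z^d$) and base $B\in\mathcal A$, $\mu(B)>0$, is given when the sets $T^{\vec v}B$, $\vec v\in R$, are pairwise disjoint; its atoms are these sets and the error set $\big(\bigcup_{\vec v\in R}T^{\vec v}B\big)^c$. The action is $\{R_k\}$ rank one if there are towers $\mathcal P_k$ of shape $R_k$ such that for every $A\in\mathcal A$ there are unions $A_k$ of atoms of $\mathcal P_k$ with $\mu(A_k\triangle A)\to 0$. It is rectangular rank one if it is $\{R_k\}$ rank one for some sequence of rectangles $R_k=[\vec m_k,\vec n_k]=\{\vec v\in\mathbb Z^d:\vec m_k\le\vec v\le\vec n_k\}$ (coordinatewise order, $\vec m_k\le\vec n_k$) which is a Følner sequence, i.e. $|R_k\triangle(R_k+\vec n)|/|R_k|\to 0$ for every $\vec n\in\mathbb Z^d$. For an $n$-dimensional subspace $V$ of $\mathbb R^d$ let $Q$ be a unit cube in $V$ with a vertex at $\vec 0$, let $Q'$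 be a unit cube in $V^\perp$ centered at $\vec 0$, let $S(V,t,m)=tQ+mQ'$, and for a finite measurable partition $\mathcal P$ let $\mathcal P_{V,t,m}=\bigvee_{\vec w\in S(V,t,m)\cap\mathbb Z^d}T^{-\vec w}\mathcal P$. With $H(\mathcal P)=-\sum_{P\in\mathcal P}\mu(P)\log\mu(P)$, put $$h_n(T,V)=\sup_{\mathcal P\text{ finite}}\ \sup_{m>0}\ \limsup_{t\to\infty}\frac1{t^n}H(\mathcal P_{V,t,m})$$ (the value does not depend on the choice of the cubes; formally, one also takes the supremum over these choices). Theorem. Suppose $T$ is rectangular rank one. Then there is a one-dimensional subspace $V$ of $\mathbb R^d$ with $h_1(T,V)=0$. Moreover, whenever $T$ is $\{R_k\}$ rank one for a Følner sequence of rectangles $R_k=[\vec m_k,\vec n_k]$, and $i\in\{1,\dots,d\}$ is such that for infinitely many $k$ the $i$-th side is a longest one, that is, $(\vec n_k-\vec m_k)_i=\max_{j}(\vec n_k-\vec m_k)_j$, then $h_1(T,\mathbb R\vec e_i)=0$, where $\vec e_i$ is the $i$-th standard basis vector. -/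

import Mathlib

open MeasureTheory Filter Topology
open scoped ENNReal Pointwise symmDiff

noncomputable section

namespace RankOne

/-! ### Lebesgue spaces and free actions

A `ℤ^d` action `T` on `X` is an `AddAction (Fin d → ℤ) X`, with `T^v x = v +ᵥ x`. -/

/-- `(X, μ)` is a Lebesgue space: up to null sets and completion it is isomorphic to the real
line with a Borel measure. The isomorphism is `f`, a measurable map that is injective on a set
`X₀` of full measure and sends measurable subsets of `X₀` to sets measurable for the
completion of the image measure. Every standard Borel space qualifies, and so does its
completion. -/
def IsLebesgueSpace {X : Type*} [MeasurableSpace X] (μ : Measure X) : Prop :=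
  ∃ (f : X → ℝ) (X₀ : Set X), Measurable f ∧ (∀ᵐ x ∂μ, x ∈ X₀) ∧ Set.InjOn f X₀ ∧
    ∀ A : Set X, MeasurableSet A → NullMeasurableSet (f '' (A ∩ X₀)) (μ.map f)

/-- The action is (essentially) free: almost every point has trivial stabilizer. -/
def IsFree (d : ℕ) {X : Type*} [MeasurableSpace X] (μ : Measure X)
    [AddAction (Fin d → ℤ) X] : Prop :=
  ∀ᵐ x ∂μ, ∀ v : Fin d → ℤ, v +ᵥ x = x → v = 0

/-! ### Shapes -/

/-- A Følner sequence of shapes: `|R_k ∆ (R_k + n)| / |R_k| → 0` for every `n ∈ ℤ^d`. -/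
def IsFolner {d : ℕ} (R : ℕ → Finset (Fin d → ℤ)) : Prop :=
  ∀ n : Fin d → ℤ, Tendsto
    (fun k => (((R k) ∆ ((R k).image fun v => v + n)).card : ℝ) / ((R k).card : ℝ))
    atTop (𝓝 0)

/-! ### Towers and rank one -/

/-- `B` is the base of a tower of shape `R`. -/
structure IsTowerBase {d : ℕ} {X : Type*} [MeasurableSpace X] [AddAction (Fin d → ℤ) X]
    (μ : Measure X) (R : Finset (Fin d → ℤ)) (B : Set X) : Prop where
  measurableSet : MeasurableSet B
  measure_pos : 0 < μ B
  disjoint : ∀ v ∈ R, ∀ w ∈ R, v ≠ w → Disjoint (v +ᵥ B) (w +ᵥ B)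

/-- The atoms of the tower partition of shape `R` and base `B`. The alphabet is `R` together
with one more symbol, here `none`, for the error set. -/
def towerAtom {d : ℕ} {X : Type*} [AddAction (Fin d → ℤ) X]
    (R : Finset (Fin d → ℤ)) (B : Set X) : Option R → Set X
  | some v => (v : Fin d → ℤ) +ᵥ B
  | none => (⋃ v ∈ R, v +ᵥ B)ᶜ

/-- For a sequence of partitions (given by their labelled atoms), `P_k → ε`: every measurable
set is asymptotically a union of atoms of `P_k`. -/
def TendstoPoints {X : Type*} [MeasurableSpace X] (μ : Measure X) {L : ℕ → Type*}
    (P : ∀ k, L k → Set X) : Prop :=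
  ∀ A : Set X, MeasurableSet A → ∃ I : ∀ k, Set (L k),
    Tendsto (fun k => μ ((⋃ a ∈ I k, P k a) ∆ A)) atTop (𝓝 0)

/-- The action is `R`-rank one: there are towers `P_k` of shape `R_k` with `P_k → ε`. -/
def IsRankOne {d : ℕ} {X : Type*} [MeasurableSpace X] [AddAction (Fin d → ℤ) X]
    (μ : Measure X) (R : ℕ → Finset (Fin d → ℤ)) : Prop :=
  ∃ B : ℕ → Set X, (∀ k, IsTowerBase μ (R k) (B k)) ∧
    TendstoPoints μ (fun k => towerAtom (R k) (B k))

/-- The action is rectangular rank one: it is `R`-rank one for a Følner sequence of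
rectangles `R_k = [m_k, n_k]`. -/
def IsRectangularRankOne (d : ℕ) {X : Type*} [MeasurableSpace X] [AddAction (Fin d → ℤ) X]
    (μ : Measure X) : Prop :=
  ∃ m n : ℕ → Fin d → ℤ, (∀ k, m k ≤ n k) ∧ IsFolner (fun k => Finset.Icc (m k) (n k)) ∧
    IsRankOne μ (fun k => Finset.Icc (m k) (n k))

/-! ### Entropy of partitions -/

/-- The entropy `-∑ μ(P_a) log μ(P_a)` of a finite partition `P : X → L`. -/
def partitionEntropy {X : Type*} [MeasurableSpace X] (μ : Measure X)
    {L : Type*} [Fintype L] (P : X → L) : ℝ :=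
  ∑ a : L, Real.negMulLog (μ.real (P ⁻¹' {a}))

/-- The join `⋁_{w ∈ F} T^{-w} P`; the atom of `T^{-w} P` with label `a` is `T^{-w} P_a`, so
that `T^{-w} P` is the function `x ↦ P (T^w x)`. -/
def joinPartition {d : ℕ} {X : Type*} [AddAction (Fin d → ℤ) X] {L : Type*}
    (F : Finset (Fin d → ℤ)) (P : X → L) : X → (F → L) :=
  fun x w => P ((w : Fin d → ℤ) +ᵥ x)

/-! ### Directional entropy -/

section Box

variable {d : ℕ} {V : Submodule ℝ (EuclideanSpace ℝ (Fin d))}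

/-- `S(V,t,m) = tQ + mQ'`, where `Q` is the unit cube in `V` spanned by the orthonormal basis
`b` of `V` and `Q'` is the unit cube in `Vᗮ` with edges along the orthonormal basis `b'` of
`Vᗮ` and centre `0`. -/
def tiltedBox (b : OrthonormalBasis (Fin (Module.finrank ℝ V)) ℝ V)
    (b' : OrthonormalBasis (Fin (Module.finrank ℝ Vᗮ)) ℝ Vᗮ) (t m : ℝ) :
    Set (EuclideanSpace ℝ (Fin d)) :=
  t • ((fun s : Fin (Module.finrank ℝ V) → ℝ =>
      ∑ i, s i • (b i : EuclideanSpace ℝ (Fin d))) '' Set.Icc 0 1) +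
  m • ((fun s : Fin (Module.finrank ℝ Vᗮ) → ℝ =>
      ∑ i, s i • (b' i : EuclideanSpace ℝ (Fin d))) ''
        Set.Icc (fun _ => -(1 / 2 : ℝ)) (fun _ => (1 / 2 : ℝ)))

theorem tiltedBox_finite (b : OrthonormalBasis (Fin (Module.finrank ℝ V)) ℝ V)
    (b' : OrthonormalBasis (Fin (Module.finrank ℝ Vᗮ)) ℝ Vᗮ) (t m : ℝ) :
    {w : Fin d → ℤ |
      (WithLp.toLp 2 (fun i => (w i : ℝ)) : EuclideanSpace ℝ (Fin d)) ∈
        tiltedBox b b' t m}.Finite := by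
  have hc : IsCompact (tiltedBox b b' t m) := by
    unfold tiltedBox
    refine IsCompact.add (IsCompact.smul _ (IsCompact.image isCompact_Icc ?_))
      (IsCompact.smul _ (IsCompact.image isCompact_Icc ?_)) <;> fun_prop
  obtain ⟨C, hC⟩ := hc.isBounded.exists_norm_le
  refine (Set.finite_Icc (fun _ : Fin d => -⌈C⌉) (fun _ => ⌈C⌉)).subset ?_
  intro w hw
  have key : ∀ i, |(w i : ℝ)| ≤ (⌈C⌉ : ℤ) := fun i => by
    have h1 := PiLp.norm_apply_le
      (WithLp.toLp 2 (fun i => (w i : ℝ)) : EuclideanSpace ℝ (Fin d)) i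
    rw [Real.norm_eq_abs] at h1
    exact (h1.trans (hC _ hw)).trans (Int.le_ceil C)
  constructor <;> intro i <;> have h := abs_le.mp (key i)
  · exact_mod_cast h.1
  · exact_mod_cast h.2

/-- The lattice points `S(V,t,m) ∩ ℤ^d`. -/
def latticeBox (b : OrthonormalBasis (Fin (Module.finrank ℝ V)) ℝ V)
    (b' : OrthonormalBasis (Fin (Module.finrank ℝ Vᗮ)) ℝ Vᗮ) (t m : ℝ) :
    Finset (Fin d → ℤ) :=
  (tiltedBox_finite b b' t m).toFinset

end Box

/-- `h_n(T,V,P,m) = limsup_{t → ∞} t^{-n} H(P_{V,t,m})`, where `n = dim V`, for the cubes given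
by the orthonormal bases `b` of `V` and `b'` of `Vᗮ`. -/
def directionalEntropyAt {d : ℕ} {X : Type*} [MeasurableSpace X] [AddAction (Fin d → ℤ) X]
    (μ : Measure X) {V : Submodule ℝ (EuclideanSpace ℝ (Fin d))}
    (b : OrthonormalBasis (Fin (Module.finrank ℝ V)) ℝ V)
    (b' : OrthonormalBasis (Fin (Module.finrank ℝ Vᗮ)) ℝ Vᗮ)
    {L : Type*} [Fintype L] (P : X → L) (m : ℝ) : ℝ≥0∞ :=
  limsup (fun t : ℝ => ENNReal.ofReal
    (partitionEntropy μ (joinPartition (latticeBox b b' t m) P) /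
      t ^ Module.finrank ℝ V)) atTop

/-- `h_n(T,V) = sup_P sup_{m > 0} h_n(T,V,P,m)` with `n = dim V`, over all finite measurable
partitions `P`. The value does not depend on the choice of unit cubes in `V` and `Vᗮ`; the
supremum over all choices makes the definition free of a choice. -/
def directionalEntropy {d : ℕ} {X : Type*} [MeasurableSpace X] [AddAction (Fin d → ℤ) X]
    (μ : Measure X) (V : Submodule ℝ (EuclideanSpace ℝ (Fin d))) : ℝ≥0∞ :=
  ⨆ (b : OrthonormalBasis (Fin (Module.finrank ℝ V)) ℝ V)
    (b' : OrthonormalBasis (Fin (Module.finrank ℝ Vᗮ)) ℝ Vᗮ)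
    (N : ℕ) (P : X → Fin N) (_ : Measurable P) (m : ℝ) (_ : 0 < m),
    directionalEntropyAt μ b b' P m

end RankOne

end

/-!
A point `x` of a tower of shape `R` moves under `T^e` to the next level `v + e`, unless `T^e x`
enters the tower through one of the levels `v ∈ R` with `v - e ∉ R`. Hence the names of length `N`
of the tower partition along `e` are determined by the initial level and the entrances, and their
entropy is at most a constant plus `N` times the entropy of the partition into the entrance levels,
which is at most `(log |R| + 1) / |R|` times their number. If `R` is a rectangle whose longest side
has direction `e = e_i` and length `l`, the latter is at most `(d log l + 1) / l`. So `T^{e_i}` has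
entropy zero if `l` is unbounded along the sequence of towers; if `l` is bounded, so is the number
of atoms of the towers, and therefore the entropy of every finite partition. Finally, the lattice
points near a long segment of the `i`-th axis are covered by the translates of one fixed box along
that segment, so the directional entropy in direction `e_i` is controlled by the entropy of
`T^{e_i}`.
-/

namespace RankOne

open Asymptotics
open Real (negMulLog log)

/-! ### Entropy of finite partitions -/

section Entropy

theorem negMulLog_add_self_le {x y : ℝ} (hx : 0 ≤ x) (hy : 0 ≤ y) (h : y = 0 → x = 0) :
    negMulLog x + x ≤ y - x * log y := by
  rcases hx.eq_or_lt with rfl | hx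
  · simpa using hy
  have hy : 0 < y := hy.lt_of_ne fun h0 => hx.ne' (h h0.symm)
  have hlog : x * (log y - log x) ≤ x * (y / x - 1) := by
    rw [← Real.log_div hy.ne' hx.ne']
    exact mul_le_mul_of_nonneg_left (Real.log_le_sub_one_of_pos (by positivity)) hx.le
  rw [mul_sub_one, mul_div_cancel₀ _ hx.ne'] at hlog
  rw [negMulLog]
  linarith

theorem negMulLog_add_self_mono {x y : ℝ} (hx : 0 ≤ x) (hxy : x ≤ y) (hy : y ≤ 1) :
    negMulLog x + x ≤ negMulLog y + y := by
  have hlog := mul_le_mul_of_nonpos_right hxy (Real.log_nonpos (hx.trans hxy) hy)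
  have hle := negMulLog_add_self_le hx (hx.trans hxy) fun h => le_antisymm (h ▸ hxy) hx
  have hdef : negMulLog y = -y * log y := rfl
  linarith

theorem negMulLog_sum_le {ι : Type*} (s : Finset ι) (p : ι → ℝ) (hp : ∀ a ∈ s, 0 ≤ p a) :
    negMulLog (∑ a ∈ s, p a) ≤ ∑ a ∈ s, negMulLog (p a) := by
  rw [negMulLog, ← Finset.sum_neg_distrib, Finset.sum_mul]
  refine Finset.sum_le_sum fun a ha => ?_
  rcases (hp a ha).eq_or_lt with h | h
  · simp [← h]
  · exact mul_le_mul_of_nonpos_left (Real.log_le_log h (Finset.single_le_sum hp ha))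
      (neg_nonpos.mpr h.le)

variable {X : Type*} [MeasurableSpace X] {μ : Measure X}
  {L L' L'' : Type*}

theorem sum_measureReal_fiber [MeasurableSpace L] [MeasurableSingletonClass L] [IsFiniteMeasure μ]
    {P : X → L} (hP : Measurable P) (s : Finset L) :
    ∑ a ∈ s, μ.real (P ⁻¹' {a}) = μ.real (P ⁻¹' s) :=
  sum_measureReal_preimage_singleton s fun a _ => hP (measurableSet_singleton a)

variable [Fintype L] [Fintype L'] [Fintype L'']

theorem partitionEntropy_nonneg [IsProbabilityMeasure μ] (P : X → L) :
    0 ≤ partitionEntropy μ P :=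
  Finset.sum_nonneg fun _ _ => Real.negMulLog_nonneg measureReal_nonneg measureReal_le_one

theorem partitionEntropy_le_card (P : X → L) : partitionEntropy μ P ≤ Fintype.card L := by
  have h : ∀ a ∈ Finset.univ, negMulLog (μ.real (P ⁻¹' {a})) ≤ 1 := fun a _ =>
    (Real.negMulLog_le_one_sub_self measureReal_nonneg).trans (sub_le_self _ measureReal_nonneg)
  simpa [partitionEntropy] using Finset.sum_le_card_nsmul _ _ _ h

theorem partitionEntropy_eq_zero_of_subsingleton [IsProbabilityMeasure μ] [Subsingleton L]
    (P : X → L) : partitionEntropy μ P = 0 := by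
  refine Finset.sum_eq_zero fun a _ => ?_
  have h : P ⁻¹' {a} = Set.univ := Set.eq_univ_of_forall fun _ => Subsingleton.elim _ _
  rw [h, probReal_univ, Real.negMulLog_one]

variable [MeasurableSpace L] [MeasurableSingletonClass L]

theorem partitionEntropy_comp_measurePreserving {Y : Type*} [MeasurableSpace Y] {ν : Measure Y}
    {T : X → Y} (hT : MeasurePreserving T μ ν) {P : Y → L} (hP : Measurable P) :
    partitionEntropy μ (P ∘ T) = partitionEntropy ν P :=
  Finset.sum_congr rfl fun a _ => congrArg negMulLog <|
    hT.measureReal_preimage (hP (measurableSet_singleton a)).nullMeasurableSet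

theorem sum_measureReal_fiber_univ [IsProbabilityMeasure μ] {P : X → L} (hP : Measurable P) :
    ∑ a, μ.real (P ⁻¹' {a}) = 1 := by
  simp [sum_measureReal_fiber hP]

theorem partitionEntropy_le_of_forall_eq [IsFiniteMeasure μ] {P : X → L} {Q : X → L'}
    (hP : Measurable P) (f : L → L') (h : ∀ x, Q x = f (P x)) :
    partitionEntropy μ Q ≤ partitionEntropy μ P := by
  classical
  have hfiber : ∀ b, μ.real (Q ⁻¹' {b}) = ∑ a with f a = b, μ.real (P ⁻¹' {a}) := fun b => by
    rw [sum_measureReal_fiber hP]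
    congr 1
    ext x
    simp [h]
  unfold partitionEntropy
  rw [← Finset.sum_fiberwise Finset.univ f]
  refine Finset.sum_le_sum fun b _ => ?_
  rw [hfiber]
  exact negMulLog_sum_le _ _ fun _ _ => measureReal_nonneg

variable [MeasurableSpace L'] [MeasurableSingletonClass L']

/-- Compare the joint distribution with the product of the marginals, term by term. -/
theorem partitionEntropy_prodMk_le [IsProbabilityMeasure μ] {P : X → L} {Q : X → L'}
    (hP : Measurable P) (hQ : Measurable Q) :
    partitionEntropy μ (fun x => (P x, Q x)) ≤ partitionEntropy μ P + partitionEntropy μ Q := by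
  set p : L → ℝ := fun a => μ.real (P ⁻¹' {a})
  set q : L' → ℝ := fun b => μ.real (Q ⁻¹' {b})
  set r : L → L' → ℝ := fun a b => μ.real ((fun x => (P x, Q x)) ⁻¹' {(a, b)})
  have hPQ : Measurable fun x => (P x, Q x) := hP.prodMk hQ
  have hp : ∀ a, ∑ b, r a b = p a := fun a => by
    have h := sum_measureReal_fiber (μ := μ) hPQ ({a} ×ˢ Finset.univ)
    rw [Finset.sum_product, Finset.sum_singleton] at h
    exact h.trans (congrArg μ.real (by ext x; simp [eq_comm]))
  have hq : ∀ b, ∑ a, r a b = q b := fun b => by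
    have h := sum_measureReal_fiber (μ := μ) hPQ (Finset.univ ×ˢ {b})
    rw [Finset.sum_product_right, Finset.sum_singleton] at h
    exact h.trans (congrArg μ.real (by ext x; simp [eq_comm]))
  have hrp : ∀ a b, p a = 0 → r a b = 0 := fun a b h => le_antisymm
    (h ▸ measureReal_mono fun x hx => congrArg Prod.fst hx) measureReal_nonneg
  have hrq : ∀ a b, q b = 0 → r a b = 0 := fun a b h => le_antisymm
    (h ▸ measureReal_mono fun x hx => congrArg Prod.snd hx) measureReal_nonneg
  have hterm : ∀ a b, negMulLog (r a b) ≤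
      p a * q b - r a b - r a b * log (p a) - r a b * log (q b) := fun a b => by
    have hle := negMulLog_add_self_le (x := r a b) (y := p a * q b) measureReal_nonneg
      (mul_nonneg measureReal_nonneg measureReal_nonneg)
      fun h => (mul_eq_zero.mp h).elim (hrp a b) (hrq a b)
    by_cases hr : r a b = 0
    · simpa [hr] using hle
    · rw [Real.log_mul (mt (hrp a b) hr) (mt (hrq a b) hr)] at hle
      linarith
  have hp1 : ∑ a, p a = 1 := sum_measureReal_fiber_univ hP
  have hq1 : ∑ b, q b = 1 := sum_measureReal_fiber_univ hQ
  calc partitionEntropy μ (fun x => (P x, Q x))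
      = ∑ a, ∑ b, negMulLog (r a b) := Fintype.sum_prod_type _
    _ ≤ ∑ a, ∑ b, (p a * q b - r a b - r a b * log (p a) - r a b * log (q b)) :=
        Finset.sum_le_sum fun a _ => Finset.sum_le_sum fun b _ => hterm a b
    _ = ∑ a, -p a * log (p a) + ∑ b, -q b * log (q b) := by
        simp only [Finset.sum_sub_distrib]
        rw [← Finset.sum_mul_sum, Finset.sum_comm (f := fun a b => r a b * log (q b))]
        simp only [← Finset.sum_mul, hp, hq, hp1, hq1, neg_mul, Finset.sum_neg_distrib]
        ring

theorem partitionEntropy_le_add [IsProbabilityMeasure μ] {P : X → L} {Q : X → L'} {S : X → L''}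
    (hP : Measurable P) (hQ : Measurable Q) (f : L → L' → L'') (h : ∀ x, S x = f (P x) (Q x)) :
    partitionEntropy μ S ≤ partitionEntropy μ P + partitionEntropy μ Q :=
  (partitionEntropy_le_of_forall_eq (hP.prodMk hQ) (fun c => f c.1 c.2) h).trans
    (partitionEntropy_prodMk_le hP hQ)

end Entropy

/-! ### Names along the orbits of a transformation -/

section Itinerary

variable {X L : Type*}

/-- The name of length `N` of `x` for the partition `Q` and the transformation `T`, that is, the
label of `x` in the join `⋁_{s < N} T^{-s} Q`. -/
def itinerary (T : X → X) (Q : X → L) (N : ℕ) (x : X) : Fin N → L :=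
  fun s => Q (T^[s] x)

theorem itinerary_succ (T : X → X) (Q : X → L) (N : ℕ) (x : X) :
    itinerary T Q (N + 1) x = Fin.snoc (itinerary T Q N x) (Q (T^[N] x)) := by
  refine (Fin.snoc_init_self _).symm.trans ?_
  rfl

variable [MeasurableSpace X] {μ : Measure X} {T : X → X}

/-- `T` has entropy zero: for every finite partition, the entropy of the names of length `N` grows
sublinearly in `N`. Alphabets in `Type` suffice, since every finite partition can be relabelled by
some `Fin k`. -/
def HasZeroEntropy (μ : Measure X) (T : X → X) : Prop :=
  ∀ ⦃L : Type⦄ [Fintype L] [MeasurableSpace L] [MeasurableSingletonClass L] ⦃Q : X → L⦄,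
    Measurable Q →
      (fun N => partitionEntropy μ (itinerary T Q N)) =o[atTop] fun N : ℕ => (N : ℝ)

theorem hasZeroEntropy_of_forall_exists_le [IsProbabilityMeasure μ]
    (h : ∀ ⦃L : Type⦄ [Fintype L] [MeasurableSpace L] [MeasurableSingletonClass L] ⦃Q : X → L⦄,
      Measurable Q → ∀ ε > 0, ∃ c : ℝ, ∀ N : ℕ,
        partitionEntropy μ (itinerary T Q N) ≤ c + N * ε) :
    HasZeroEntropy μ T := by
  intro L _ _ _ Q hQ
  refine IsLittleO.of_bound fun ε hε => ?_
  obtain ⟨c, hc⟩ := h hQ (ε / 2) (half_pos hε)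
  filter_upwards [tendsto_natCast_atTop_atTop.eventually_ge_atTop (c / (ε / 2))] with N hN
  rw [Real.norm_of_nonneg (partitionEntropy_nonneg _), Real.norm_natCast]
  rw [div_le_iff₀ (half_pos hε)] at hN
  linarith [hc N]

variable [MeasurableSpace L]

theorem measurable_itinerary (hT : Measurable T) {Q : X → L} (hQ : Measurable Q) (N : ℕ) :
    Measurable (itinerary T Q N) :=
  measurable_pi_lambda _ fun s => hQ.comp (hT.iterate s)

variable [IsProbabilityMeasure μ] [Fintype L] [MeasurableSingletonClass L]

theorem partitionEntropy_itinerary_le (hT : MeasurePreserving T μ μ) {Q : X → L}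
    (hQ : Measurable Q) (N : ℕ) :
    partitionEntropy μ (itinerary T Q N) ≤ N * partitionEntropy μ Q := by
  induction N with
  | zero => simp [partitionEntropy_eq_zero_of_subsingleton]
  | succ N ih =>
    have h := partitionEntropy_le_add (μ := μ) (measurable_itinerary hT.measurable hQ N)
      (hQ.comp (hT.iterate N).measurable) (fun c a => Fin.snoc (α := fun _ => L) c a)
      (itinerary_succ T Q N)
    rw [partitionEntropy_comp_measurePreserving (hT.iterate N) hQ] at h
    push_cast
    linarith

theorem partitionEntropy_itinerary_le_of_step {C : Type*} [Fintype C] [MeasurableSpace C]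
    [MeasurableSingletonClass C] (hT : MeasurePreserving T μ μ) {P : X → L} {F : X → C}
    (hP : Measurable P) (hF : Measurable F) (step : L → C → L)
    (hstep : ∀ x, P (T x) = step (P x) (F (T x))) (N : ℕ) :
    partitionEntropy μ (itinerary T P N) ≤
      partitionEntropy μ P + N * partitionEntropy μ F := by
  obtain _ | N := N
  · simpa [partitionEntropy_eq_zero_of_subsingleton] using partitionEntropy_nonneg P
  suffices h : partitionEntropy μ (itinerary T P (N + 1)) ≤
      partitionEntropy μ P + N * partitionEntropy μ F by
    push_cast
    linarith [partitionEntropy_nonneg (μ := μ) F]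
  induction N with
  | zero => simpa using partitionEntropy_itinerary_le hT hP 1
  | succ N ih =>
    have hlast : ∀ x, itinerary T P (N + 2) x = Fin.snoc (itinerary T P (N + 1) x)
        (step (itinerary T P (N + 1) x (Fin.last N)) (F (T^[N + 1] x))) := fun x => by
      rw [itinerary_succ, Function.iterate_succ_apply', hstep]
      rfl
    have h := partitionEntropy_le_add (μ := μ) (measurable_itinerary hT.measurable hP (N + 1))
      (hF.comp (hT.iterate (N + 1)).measurable)
      (fun c a => Fin.snoc (α := fun _ => L) c (step (c (Fin.last N)) a)) hlast
    rw [partitionEntropy_comp_measurePreserving (hT.iterate (N + 1)) hF] at h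
    push_cast
    linarith

end Itinerary

/-! ### Approximation of partitions -/

/-- A countable partition with labels in `Option L` is measurable if and only if its atoms are. -/
local instance {L : Type*} : MeasurableSpace (Option L) := ⊤

section Approximation

variable {X : Type*}

open Classical in
/-- The correction that turns the approximation `Q'` of the partition `Q` into `Q`: it records the
label of `Q` where the two differ, and is constant elsewhere. -/
noncomputable def correction {L : Type*} (Q Q' : X → L) (x : X) : Option L :=
  if Q x = Q' x then none else some (Q x)

theorem getD_correction {L : Type*} (Q Q' : X → L) (x : X) :
    (correction Q Q' x).getD (Q' x) = Q x := by
  unfold correction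
  split_ifs with h <;> simp [h]

variable [MeasurableSpace X] {μ : Measure X}

/-- The function `y ↦ negMulLog y + y` is monotone on `[0, 1]`, and the atom `none` contributes at
most the measure of its complement. -/
theorem partitionEntropy_option_le {L : Type*} [Fintype L] [IsProbabilityMeasure μ]
    {P : X → Option L} (hP : Measurable P) (S : Finset L) (hS : ∀ x a, P x = some a → a ∈ S)
    {q : ℝ} (hq : q ≤ 1) (hPq : ∀ a ∈ S, μ.real (P ⁻¹' {some a}) ≤ q) :
    partitionEntropy μ P ≤ S.card * (negMulLog q + q) := by
  have hempty : ∀ a ∉ S, μ.real (P ⁻¹' {some a}) = 0 := fun a ha => by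
    have h : P ⁻¹' {some a} = ∅ := Set.eq_empty_of_forall_notMem fun x hx => ha (hS x a hx)
    rw [h, measureReal_empty]
  have hsum : ∀ f : ℝ → ℝ, f 0 = 0 →
      ∑ a, f (μ.real (P ⁻¹' {some a})) = ∑ a ∈ S, f (μ.real (P ⁻¹' {some a})) := fun f hf =>
    (Finset.sum_subset S.subset_univ fun a _ ha => by rw [hempty a ha, hf]).symm
  have htotal := sum_measureReal_fiber_univ (μ := μ) hP
  rw [Fintype.sum_option, hsum (fun y => y) rfl] at htotal
  have hnone := Real.negMulLog_le_one_sub_self (measureReal_nonneg (μ := μ) (s := P ⁻¹' {none}))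
  calc partitionEntropy μ P
      = negMulLog (μ.real (P ⁻¹' {none})) + ∑ a ∈ S, negMulLog (μ.real (P ⁻¹' {some a})) := by
        rw [partitionEntropy, Fintype.sum_option, hsum _ Real.negMulLog_zero]
    _ ≤ ∑ a ∈ S, (negMulLog (μ.real (P ⁻¹' {some a})) + μ.real (P ⁻¹' {some a})) := by
        rw [Finset.sum_add_distrib]
        linarith
    _ ≤ S.card * (negMulLog q + q) := by
        rw [← nsmul_eq_mul]
        exact Finset.sum_le_card_nsmul _ _ _ fun a ha =>
          negMulLog_add_self_mono measureReal_nonneg (hPq a ha) hq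

variable {L : Type*} [MeasurableSpace L] [MeasurableSingletonClass L]

theorem measurable_correction [Finite L] {Q Q' : X → L} (hQ : Measurable Q) (hQ' : Measurable Q') :
    Measurable (correction Q Q') := by
  classical
  exact (Measurable.of_discrete (f := fun c : L × L => if c.1 = c.2 then none else some c.1)).comp
    (hQ.prodMk hQ')

variable [IsProbabilityMeasure μ]

theorem TendstoPoints.eventually_exists_measureReal_ne_le [Finite L] {A : ℕ → Type*}
    {P : ∀ k, X → A k} (h : TendstoPoints μ fun k a => P k ⁻¹' {a}) {Q : X → L} (hQ : Measurable Q)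
    {δ : ℝ} (hδ : 0 < δ) :
    ∀ᶠ k in atTop, ∃ g : A k → L, μ.real {x | Q x ≠ g (P k x)} ≤ δ := by
  classical
  cases nonempty_fintype L
  have : Nonempty L := (nonempty_of_isProbabilityMeasure μ).map Q
  choose I hI using fun a => h (Q ⁻¹' {a}) (hQ (measurableSet_singleton a))
  have hlim : Tendsto (fun k => ∑ a, μ ((⋃ c ∈ I a k, P k ⁻¹' {c}) ∆ (Q ⁻¹' {a}))) atTop
      (𝓝 0) := by
    simpa using tendsto_finsetSum Finset.univ fun a _ => hI a
  filter_upwards [hlim.eventually (ge_mem_nhds (ENNReal.ofReal_pos.mpr hδ))] with k hk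
  refine ⟨fun c => if h : ∃ a, c ∈ I a k then h.choose else Classical.arbitrary L, ?_⟩
  refine ENNReal.toReal_le_of_le_ofReal hδ.le (le_trans ?_ hk)
  refine (measure_mono fun x hx => ?_).trans (measure_iUnion_fintype_le _ _)
  rw [Set.mem_iUnion]
  by_cases hQx : P k x ∈ I (Q x) k
  · have hex : ∃ a, P k x ∈ I a k := ⟨_, hQx⟩
    simp only [Set.mem_ofPred_eq, dif_pos hex] at hx
    exact ⟨hex.choose, Or.inl ⟨by simpa using hex.choose_spec, fun h => hx h⟩⟩
  · exact ⟨Q x, Or.inr ⟨rfl, by simpa using hQx⟩⟩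

variable [Fintype L]

theorem partitionEntropy_correction_le {Q Q' : X → L} (hQ : Measurable Q) (hQ' : Measurable Q')
    {δ : ℝ} (hδ : δ ≤ 1) (h : μ.real {x | Q x ≠ Q' x} ≤ δ) :
    partitionEntropy μ (correction Q Q') ≤ Fintype.card L * (negMulLog δ + δ) := by
  refine partitionEntropy_option_le (measurable_correction hQ hQ') Finset.univ
    (fun _ a _ => Finset.mem_univ a) hδ fun a _ => (measureReal_mono fun x hx hne => ?_).trans h
  simp [correction, hne] at hx

theorem partitionEntropy_le_add_correction {Q Q' : X → L} (hQ : Measurable Q)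
    (hQ' : Measurable Q') :
    partitionEntropy μ Q ≤ partitionEntropy μ Q' + partitionEntropy μ (correction Q Q') :=
  partitionEntropy_le_add hQ' (measurable_correction hQ hQ') (fun a c => c.getD a)
    fun x => (getD_correction Q Q' x).symm

theorem partitionEntropy_itinerary_le_add_correction {T : X → X} (hT : MeasurePreserving T μ μ)
    {Q Q' : X → L} (hQ : Measurable Q) (hQ' : Measurable Q') (N : ℕ) :
    partitionEntropy μ (itinerary T Q N) ≤
      partitionEntropy μ (itinerary T Q' N) + N * partitionEntropy μ (correction Q Q') := by
  have hE := measurable_correction hQ hQ'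
  have h := partitionEntropy_le_add (μ := μ) (S := itinerary T Q N)
    (measurable_itinerary hT.measurable hQ' N) (measurable_itinerary hT.measurable hE N)
    (fun a c s => (c s).getD (a s)) fun x => funext fun s => (getD_correction Q Q' _).symm
  linarith [partitionEntropy_itinerary_le hT hE N]

theorem TendstoPoints.eventually_exists_partitionEntropy_correction_le {A : ℕ → Type*}
    [∀ k, Finite (A k)] [∀ k, MeasurableSpace (A k)] [∀ k, MeasurableSingletonClass (A k)]
    {P : ∀ k, X → A k} (h : TendstoPoints μ fun k a => P k ⁻¹' {a})
    (hP : ∀ k, Measurable (P k)) {Q : X → L} (hQ : Measurable Q) {ε : ℝ} (hε : 0 < ε) :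
    ∀ᶠ k in atTop, ∃ g : A k → L, partitionEntropy μ (correction Q (g ∘ P k)) ≤ ε := by
  obtain ⟨δ, hδε, hδ1, hδ0⟩ :
      ∃ δ : ℝ, Fintype.card L * (negMulLog δ + δ) ≤ ε ∧ δ ≤ 1 ∧ 0 < δ := by
    have hlim : Tendsto (fun δ => Fintype.card L * (negMulLog δ + δ)) (𝓝[>] 0) (𝓝 0) := by
      have hcont : Continuous fun δ => Fintype.card L * (negMulLog δ + δ) := by fun_prop
      simpa using (hcont.tendsto 0).mono_left nhdsWithin_le_nhds
    exact ((hlim.eventually_le_const hε).and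
      ((eventually_le_nhds one_pos).filter_mono nhdsWithin_le_nhds |>.and
        self_mem_nhdsWithin)).exists
  filter_upwards [h.eventually_exists_measureReal_ne_le hQ hδ0] with k ⟨g, hg⟩
  exact ⟨g, (partitionEntropy_correction_le hQ
    (Measurable.of_discrete.comp (hP k)) hδ1 hg).trans hδε⟩

end Approximation

/-! ### Labels of a tower -/

section Tower

variable {d : ℕ} {X : Type*} [MeasurableSpace X] {μ : Measure X}
  [AddAction (Fin d → ℤ) X] {R : Finset (Fin d → ℤ)} {B : Set X}

open Classical in
/-- The level of the tower of shape `R` and base `B` that contains a point, if there is one. If the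
levels are not disjoint, the choice among them is arbitrary. -/
noncomputable def towerLabel (R : Finset (Fin d → ℤ)) (B : Set X) (x : X) : Option R :=
  if h : ∃ v : R, x ∈ (v : Fin d → ℤ) +ᵥ B then some h.choose else none

theorem towerLabel_eq_some_iff (hB : IsTowerBase μ R B) {x : X} {v : R} :
    towerLabel R B x = some v ↔ x ∈ (v : Fin d → ℤ) +ᵥ B := by
  unfold towerLabel
  split_ifs with h
  · rw [Option.some_inj]
    refine ⟨fun hv => hv ▸ h.choose_spec, fun hv => ?_⟩
    by_contra hne
    exact Set.disjoint_left.mp (hB.disjoint _ h.choose.2 v v.2 fun h' => hne (Subtype.ext h'))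
      h.choose_spec hv
  · simp only [false_iff]
    exact fun hv => h ⟨v, hv⟩

theorem preimage_towerLabel (hB : IsTowerBase μ R B) (a : Option R) :
    towerLabel R B ⁻¹' {a} = towerAtom R B a := by
  ext x
  rw [Set.mem_preimage, Set.mem_singleton_iff]
  cases a with
  | some v => exact towerLabel_eq_some_iff hB
  | none =>
    rw [Option.eq_none_iff_forall_ne_some]
    simp only [ne_eq, towerLabel_eq_some_iff hB, towerAtom, Set.mem_compl_iff, Set.mem_iUnion,
      not_exists, Subtype.forall]

theorem measurable_towerLabel [MeasurableConstVAdd (Fin d → ℤ) X] (hB : IsTowerBase μ R B) :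
    Measurable (towerLabel R B) := by
  refine measurable_to_countable' fun a => ?_
  rw [preimage_towerLabel hB]
  cases a with
  | some v => exact hB.measurableSet.const_vadd _
  | none =>
    exact (Finset.measurableSet_biUnion _ fun v _ => hB.measurableSet.const_vadd _).compl

/-- The part of the boundary of `R` through which translation by `e` enters `R`. -/
def entrance (e : Fin d → ℤ) (R : Finset (Fin d → ℤ)) : Finset (Fin d → ℤ) :=
  R.filter fun v => v - e ∉ R

/-- The level of a point in the tower of shape `R` and base `B`, if it lies in `entrance e R`. -/
noncomputable def entranceLabel (e : Fin d → ℤ) (R : Finset (Fin d → ℤ)) (B : Set X) (x : X) :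
    Option R :=
  (towerLabel R B x).filter fun v => v.1 - e ∉ R

theorem measurable_entranceLabel [MeasurableConstVAdd (Fin d → ℤ) X] (hB : IsTowerBase μ R B)
    (e : Fin d → ℤ) : Measurable (entranceLabel e R B) :=
  (Measurable.of_discrete (f := Option.filter fun v : R => v.1 - e ∉ R)).comp
    (measurable_towerLabel hB)

/-- The tower label after a step by `e`, given the tower label before the step and the entrance
label after it. -/
def nextLabel (e : Fin d → ℤ) (R : Finset (Fin d → ℤ)) : Option R → Option R → Option R
  | _, some v => some v
  | none, none => none
  | some v, none => if h : (v : Fin d → ℤ) + e ∈ R then some ⟨_, h⟩ else none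

theorem towerLabel_vadd (hB : IsTowerBase μ R B) (e : Fin d → ℤ) (x : X) :
    towerLabel R B (e +ᵥ x) =
      nextLabel e R (towerLabel R B x) (entranceLabel e R B (e +ᵥ x)) := by
  have hshift : ∀ v w : R, (w : Fin d → ℤ) = v + e →
      (towerLabel R B x = some v ↔ towerLabel R B (e +ᵥ x) = some w) := fun v w hvw => by
    rw [towerLabel_eq_some_iff hB, towerLabel_eq_some_iff hB, hvw, add_comm, ← vadd_vadd,
      Set.vadd_mem_vadd_set_iff]
  rcases h : towerLabel R B (e +ᵥ x) with _ | w
  · rw [entranceLabel, h, Option.filter_none]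
    rcases h' : towerLabel R B x with _ | v
    · rfl
    · have hv : (v : Fin d → ℤ) + e ∉ R := fun hv => by
        simpa [h] using (hshift v ⟨_, hv⟩ rfl).mp h'
      rw [nextLabel, dif_neg hv]
  · by_cases hw : w.1 - e ∈ R
    · have h' := (hshift ⟨_, hw⟩ w (sub_add_cancel _ _).symm).mpr h
      rw [entranceLabel, h, h', Option.filter_some_neg (by simpa using hw), nextLabel]
      simp
    · rw [entranceLabel, h, Option.filter_some_pos (by simpa using hw), nextLabel]

variable [IsProbabilityMeasure μ] [MeasurableConstVAdd (Fin d → ℤ) X]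
  [VAddInvariantMeasure (Fin d → ℤ) X μ]

theorem card_mul_measureReal_base_le_one (hB : IsTowerBase μ R B) : R.card * μ.real B ≤ 1 := by
  have h := measureReal_biUnion_finset (μ := μ) (s := R) (f := fun v => v +ᵥ B)
    (fun v hv w hw hvw => hB.disjoint v hv w hw hvw) (fun v _ => hB.measurableSet.const_vadd v)
  simp only [Measure.real, measure_vadd, Finset.sum_const, nsmul_eq_mul] at h
  rw [Measure.real, ← h]
  exact measureReal_le_one

theorem partitionEntropy_entranceLabel_le (hB : IsTowerBase μ R B) (e : Fin d → ℤ) :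
    partitionEntropy μ (entranceLabel e R B) ≤
      (entrance e R).card / R.card * (log R.card + 1) := by
  have hatom : ∀ v : R, μ.real (entranceLabel e R B ⁻¹' {some v}) ≤ (R.card : ℝ)⁻¹ := fun v => by
    have hpos : (0 : ℝ) < R.card := by exact_mod_cast R.card_pos.mpr ⟨v, v.2⟩
    have hsub : entranceLabel e R B ⁻¹' {some v} ⊆ (v : Fin d → ℤ) +ᵥ B := fun x hx =>
      (towerLabel_eq_some_iff hB).mp (Option.filter_eq_some_iff.mp hx).1
    refine (measureReal_mono hsub).trans ?_
    rw [Measure.real, measure_vadd, ← Measure.real, ← one_div, le_div_iff₀' hpos]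
    exact card_mul_measureReal_base_le_one hB
  have hcard : ((entrance e R).subtype (· ∈ R)).card = (entrance e R).card := by
    have hsub : ∀ v ∈ entrance e R, v ∈ R := fun v hv => (Finset.mem_filter.mp hv).1
    rw [Finset.card_subtype, Finset.filter_true_of_mem hsub]
  refine (partitionEntropy_option_le (measurable_entranceLabel hB e)
    ((entrance e R).subtype (· ∈ R)) (fun x v hv => ?_) (Nat.cast_inv_le_one _)
    fun v _ => hatom v).trans_eq ?_
  · simpa [entrance] using (Option.filter_eq_some_iff.mp hv).2
  · rw [hcard, negMulLog, Real.log_inv]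
    ring

end Tower

/-! ### Rank one transformations -/

section RankOne

variable {d : ℕ} {X : Type*} [MeasurableSpace X] {μ : Measure X} [AddAction (Fin d → ℤ) X]
  {R : ℕ → Finset (Fin d → ℤ)}

theorem IsRankOne.exists_tendstoPoints_towerLabel (hR : IsRankOne μ R) :
    ∃ B : ℕ → Set X, (∀ k, IsTowerBase μ (R k) (B k)) ∧
      TendstoPoints μ fun k a => towerLabel (R k) (B k) ⁻¹' {a} := by
  obtain ⟨B, hB, hlim⟩ := hR
  exact ⟨B, hB, by simpa only [preimage_towerLabel (hB _)] using hlim⟩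

variable [IsProbabilityMeasure μ] [MeasurableConstVAdd (Fin d → ℤ) X]

/-- Every finite partition, in particular the one into the names of any length, is close to one
with at most `M + 1` atoms. -/
theorem IsRankOne.hasZeroEntropy_of_frequently_card_le (hR : IsRankOne μ R) {M : ℕ}
    (hM : ∃ᶠ k in atTop, (R k).card ≤ M) {T : X → X} (hT : MeasurePreserving T μ μ) :
    HasZeroEntropy μ T := by
  obtain ⟨B, hB, hlim⟩ := hR.exists_tendstoPoints_towerLabel
  refine hasZeroEntropy_of_forall_exists_le fun L _ _ _ Q hQ ε hε => ⟨M + 1 + 1, fun N => ?_⟩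
  have hQN := measurable_itinerary hT.measurable hQ N
  obtain ⟨k, hk, g, hg⟩ := (hM.and_eventually
    (hlim.eventually_exists_partitionEntropy_correction_le (fun k => measurable_towerLabel (hB k))
      hQN one_pos)).exists
  have hmeas := measurable_towerLabel (hB k)
  have hcard : (Fintype.card (Option (R k)) : ℝ) ≤ M + 1 := by
    rw [Fintype.card_option, Fintype.card_coe]
    exact_mod_cast Nat.succ_le_succ hk
  calc partitionEntropy μ (itinerary T Q N)
      ≤ partitionEntropy μ (g ∘ towerLabel (R k) (B k)) + 1 :=
        (partitionEntropy_le_add_correction hQN (Measurable.of_discrete.comp hmeas)).trans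
          (by gcongr)
    _ ≤ partitionEntropy μ (towerLabel (R k) (B k)) + 1 := by
        gcongr
        exact partitionEntropy_le_of_forall_eq hmeas g fun _ => rfl
    _ ≤ M + 1 + 1 := by
        gcongr
        exact (partitionEntropy_le_card _).trans hcard
    _ ≤ M + 1 + 1 + N * ε := le_add_of_nonneg_right (by positivity)

theorem IsRankOne.hasZeroEntropy_vadd [VAddInvariantMeasure (Fin d → ℤ) X μ]
    (hR : IsRankOne μ R) (e : Fin d → ℤ)
    (he : ∀ ε > 0, ∃ᶠ k in atTop,
      (entrance e (R k)).card / (R k).card * (log (R k).card + 1) ≤ ε) :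
    HasZeroEntropy μ fun x : X => e +ᵥ x := by
  obtain ⟨B, hB, hlim⟩ := hR.exists_tendstoPoints_towerLabel
  refine hasZeroEntropy_of_forall_exists_le fun L _ _ _ Q hQ ε hε => ?_
  obtain ⟨k, hk, g, hg⟩ := ((he (ε / 2) (half_pos hε)).and_eventually
    (hlim.eventually_exists_partitionEntropy_correction_le (fun k => measurable_towerLabel (hB k))
      hQ (half_pos hε))).exists
  set P := towerLabel (R k) (B k)
  set T : X → X := fun x => e +ᵥ x
  have hT : MeasurePreserving T μ μ := measurePreserving_vadd e μ
  have hP : Measurable P := measurable_towerLabel (hB k)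
  refine ⟨partitionEntropy μ P, fun N => ?_⟩
  calc partitionEntropy μ (itinerary T Q N)
      ≤ partitionEntropy μ (itinerary T (g ∘ P) N) +
          N * partitionEntropy μ (correction Q (g ∘ P)) :=
        partitionEntropy_itinerary_le_add_correction hT hQ (Measurable.of_discrete.comp hP) N
    _ ≤ partitionEntropy μ (itinerary T P N) + N * (ε / 2) := by
        gcongr
        exact partitionEntropy_le_of_forall_eq (measurable_itinerary hT.measurable hP N)
          (fun c s => g (c s)) fun _ => rfl
    _ ≤ partitionEntropy μ P + N * partitionEntropy μ (entranceLabel e (R k) (B k)) +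
          N * (ε / 2) := by
        gcongr
        exact partitionEntropy_itinerary_le_of_step hT hP (measurable_entranceLabel (hB k) e)
          (nextLabel e (R k)) (towerLabel_vadd (hB k) e) N
    _ ≤ partitionEntropy μ P + N * (ε / 2) + N * (ε / 2) := by
        gcongr
        exact (partitionEntropy_entranceLabel_le (hB k) e).trans hk
    _ = partitionEntropy μ P + N * ε := by ring

end RankOne

/-! ### Rectangles -/

section Rectangle

variable {d : ℕ} {m n : Fin d → ℤ}

theorem entrance_single_Icc (hmn : m ≤ n) (i : Fin d) :
    entrance (Pi.single i 1) (Finset.Icc m n) = Finset.Icc m (Function.update n i (m i)) := by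
  ext v
  have hsingle : v - Pi.single i 1 ≤ v := sub_le_self _ (Pi.single_nonneg.mpr zero_le_one)
  rw [entrance, Finset.mem_filter, Finset.mem_Icc, Finset.mem_Icc, Finset.mem_Icc, le_update_iff]
  constructor
  · rintro ⟨⟨hmv, hvn⟩, hv⟩
    refine ⟨hmv, not_lt.mp fun hlt => hv ⟨fun j => ?_, hsingle.trans hvn⟩, fun j _ => hvn j⟩
    rcases eq_or_ne j i with rfl | hj
    · simpa using Int.le_sub_one_of_lt hlt
    · simpa [hj] using hmv j
  · rintro ⟨hmv, hvi, hvn⟩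
    refine ⟨⟨hmv, fun j => ?_⟩, fun hv => ?_⟩
    · rcases eq_or_ne j i with rfl | hj
      · exact hvi.trans (hmn j)
      · exact hvn j hj
    · have hmi : m i ≤ v i - 1 := by simpa using hv.1 i
      omega

theorem card_entrance_single_Icc_mul (hmn : m ≤ n) (i : Fin d) :
    (entrance (Pi.single i 1) (Finset.Icc m n)).card * (Finset.Icc (m i) (n i)).card =
      (Finset.Icc m n).card := by
  rw [entrance_single_Icc hmn, Pi.card_Icc, Pi.card_Icc,
    ← Finset.prod_erase_mul _ _ (Finset.mem_univ i),
    ← Finset.prod_erase_mul _ (fun j => (Finset.Icc (m j) (n j)).card) (Finset.mem_univ i),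
    Function.update_self, Finset.Icc_self, Finset.card_singleton, mul_one]
  congr 1
  exact Finset.prod_congr rfl fun j hj => by
    rw [Function.update_of_ne (Finset.ne_of_mem_erase hj)]

theorem card_Icc_le_pow {i : Fin d} (hi : ∀ j, n j - m j ≤ n i - m i) :
    (Finset.Icc m n).card ≤ (Finset.Icc (m i) (n i)).card ^ d := by
  have h := Finset.prod_le_pow_card Finset.univ (fun j => (Finset.Icc (m j) (n j)).card)
    (Finset.Icc (m i) (n i)).card fun j _ => by
      rw [Int.card_Icc, Int.card_Icc]
      have := hi j
      omega
  rwa [Finset.card_fin, ← Pi.card_Icc] at h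

theorem card_entrance_single_Icc_div_mul_le (hmn : m ≤ n) {i : Fin d}
    (hi : ∀ j, n j - m j ≤ n i - m i) :
    (entrance (Pi.single i 1) (Finset.Icc m n)).card / (Finset.Icc m n).card *
        (log (Finset.Icc m n).card + 1) ≤
      (d * log (Finset.Icc (m i) (n i)).card + 1) / (Finset.Icc (m i) (n i)).card := by
  have hR : (0 : ℝ) < (Finset.Icc m n).card := by
    exact_mod_cast Finset.card_pos.mpr (Finset.nonempty_Icc.mpr hmn)
  have hmul : ((entrance (Pi.single i 1) (Finset.Icc m n)).card : ℝ) *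
      (Finset.Icc (m i) (n i)).card = (Finset.Icc m n).card := by
    exact_mod_cast card_entrance_single_Icc_mul hmn i
  have hlog : log (Finset.Icc m n).card ≤ d * log (Finset.Icc (m i) (n i)).card := by
    rw [← Real.log_pow]
    exact Real.log_le_log hR (by exact_mod_cast card_Icc_le_pow hi)
  have hratio : ((entrance (Pi.single i 1) (Finset.Icc m n)).card : ℝ) / (Finset.Icc m n).card =
      ((Finset.Icc (m i) (n i)).card : ℝ)⁻¹ := by
    rw [← hmul] at hR ⊢
    rw [div_mul_cancel_left₀ (left_ne_zero_of_mul hR.ne')]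
  rw [hratio, div_eq_inv_mul]
  gcongr

theorem tendsto_mul_log_add_one_div (c : ℝ) :
    Tendsto (fun l : ℕ => (c * log l + 1) / l) atTop (𝓝 0) := by
  have hone : (fun _ : ℝ => (1 : ℝ)) =o[atTop] (id : ℝ → ℝ) := isLittleO_const_id_atTop 1
  exact (((Real.isLittleO_log_id_atTop.const_mul_left c).add hone).tendsto_div_nhds_zero).comp
    tendsto_natCast_atTop_atTop

theorem IsRankOne.hasZeroEntropy_of_frequently_longest_side {X : Type*} [MeasurableSpace X]
    {μ : Measure X} [IsProbabilityMeasure μ] [AddAction (Fin d → ℤ) X]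
    [MeasurableConstVAdd (Fin d → ℤ) X] [VAddInvariantMeasure (Fin d → ℤ) X μ]
    {m n : ℕ → Fin d → ℤ} (hmn : ∀ k, m k ≤ n k)
    (hR : IsRankOne μ fun k => Finset.Icc (m k) (n k)) {i : Fin d}
    (hi : ∃ᶠ k in atTop, ∀ j, n k j - m k j ≤ n k i - m k i) :
    HasZeroEntropy μ fun x : X => (Pi.single i 1 : Fin d → ℤ) +ᵥ x := by
  by_cases hbdd : ∃ M, ∃ᶠ k in atTop, (∀ j, n k j - m k j ≤ n k i - m k i) ∧
      (Finset.Icc (m k i) (n k i)).card ≤ M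
  · obtain ⟨M, hM⟩ := hbdd
    exact hR.hasZeroEntropy_of_frequently_card_le (M := M ^ d)
      (hM.mono fun k hk => (card_Icc_le_pow hk.1).trans (Nat.pow_le_pow_left hk.2 d))
      (measurePreserving_vadd _ μ)
  · simp only [not_exists, not_frequently, not_and, not_le] at hbdd
    refine hR.hasZeroEntropy_vadd _ fun ε hε => ?_
    obtain ⟨M, hM⟩ := eventually_atTop.mp
      ((tendsto_mul_log_add_one_div d).eventually_le_const hε)
    exact (hi.and_eventually (hbdd M)).mono fun k ⟨hk, hMk⟩ =>
      (card_entrance_single_Icc_div_mul_le (hmn k) hk).trans (hM _ (hMk hk).le)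

end Rectangle

/-! ### Lattice points near an axis -/

section LatticeBox

theorem norm_sum_smul_orthonormal_le {E ι : Type*} [NormedAddCommGroup E] [InnerProductSpace ℝ E]
    [Fintype ι] {V : Submodule ℝ E} (b : OrthonormalBasis ι ℝ V) {s : ι → ℝ}
    (hs : ∀ j, |s j| ≤ 1) : ‖∑ j, s j • (b j : E)‖ ≤ Fintype.card ι := by
  have hterm : ∀ j ∈ Finset.univ, ‖s j • (b j : E)‖ ≤ 1 := fun j _ => by
    rw [norm_smul, Real.norm_eq_abs, ← Submodule.coe_norm, b.orthonormal.1 j, mul_one]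
    exact hs j
  simpa using (norm_sum_le _ _).trans (Finset.sum_le_card_nsmul _ _ _ hterm)

variable {d : ℕ}

theorem exists_add_of_mem_latticeBox {V : Submodule ℝ (EuclideanSpace ℝ (Fin d))}
    (b : OrthonormalBasis (Fin (Module.finrank ℝ V)) ℝ V)
    (b' : OrthonormalBasis (Fin (Module.finrank ℝ Vᗮ)) ℝ Vᗮ) {t r : ℝ} {w : Fin d → ℤ}
    (hw : w ∈ latticeBox b b' t r) :
    ∃ p ∈ V, ∃ q ∈ Vᗮ, (∀ j, (w j : ℝ) = p j + q j) ∧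
      ‖p‖ ≤ |t| * Module.finrank ℝ V ∧ ‖q‖ ≤ |r| * Module.finrank ℝ Vᗮ := by
  rw [latticeBox, Set.Finite.mem_toFinset, Set.mem_ofPred_eq, tiltedBox, Set.mem_add] at hw
  obtain ⟨_, ⟨_, ⟨s, ⟨hs0, hs1⟩, rfl⟩, rfl⟩, _, ⟨_, ⟨s', ⟨hs0', hs1'⟩, rfl⟩, rfl⟩, hw⟩ := hw
  have hs : ∀ j, |s j| ≤ 1 := fun j =>
    abs_le.mpr ⟨(neg_nonpos.mpr zero_le_one).trans (hs0 j), hs1 j⟩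
  have hs' : ∀ j, |s' j| ≤ 1 := fun j =>
    (abs_le.mpr ⟨hs0' j, hs1' j⟩).trans one_half_lt_one.le
  refine ⟨t • ∑ j, s j • (b j : EuclideanSpace ℝ (Fin d)),
    V.smul_mem t (V.sum_mem fun j _ => V.smul_mem (s j) (b j).2),
    r • ∑ j, s' j • (b' j : EuclideanSpace ℝ (Fin d)),
    Vᗮ.smul_mem r (Vᗮ.sum_mem fun j _ => Vᗮ.smul_mem (s' j) (b' j).2), fun j => ?_, ?_, ?_⟩
  · exact (congrArg (fun u : EuclideanSpace ℝ (Fin d) => u j) hw).symm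
  · rw [norm_smul, Real.norm_eq_abs]
    gcongr
    simpa using norm_sum_smul_orthonormal_le b hs
  · rw [norm_smul, Real.norm_eq_abs]
    gcongr
    simpa using norm_sum_smul_orthonormal_le b' hs'

variable {i : Fin d}
  (b : OrthonormalBasis (Fin (Module.finrank ℝ
    (Submodule.span ℝ {EuclideanSpace.single i (1 : ℝ)}))) ℝ
    (Submodule.span ℝ {EuclideanSpace.single i (1 : ℝ)}))
  (b' : OrthonormalBasis (Fin (Module.finrank ℝ
    (Submodule.span ℝ {EuclideanSpace.single i (1 : ℝ)})ᗮ)) ℝ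
    (Submodule.span ℝ {EuclideanSpace.single i (1 : ℝ)})ᗮ)

theorem abs_apply_le_of_mem_latticeBox_single {t r : ℝ} {w : Fin d → ℤ}
    (hw : w ∈ latticeBox b b' t r) : |(w i : ℝ)| ≤ |t| ∧ ∀ j ≠ i, |(w j : ℝ)| ≤ |r| * d := by
  obtain ⟨p, hp, q, hq, hwpq, hpt, hqr⟩ := exists_add_of_mem_latticeBox b b' hw
  have hqi : q i = 0 := by
    simpa [EuclideanSpace.inner_single_left] using
      Submodule.mem_orthogonal_singleton_iff_inner_right.mp hq
  have hpj : ∀ j ≠ i, p j = 0 := fun j hj => by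
    obtain ⟨c, rfl⟩ := Submodule.mem_span_singleton.mp hp
    simp [hj]
  constructor
  · rw [finrank_span_singleton (by simp), Nat.cast_one, mul_one] at hpt
    rw [hwpq, hqi, add_zero]
    exact (PiLp.norm_apply_le p i).trans hpt
  · intro j hj
    have hd : Module.finrank ℝ (Submodule.span ℝ {EuclideanSpace.single i (1 : ℝ)})ᗮ ≤ d :=
      (Submodule.finrank_le _).trans_eq finrank_euclideanSpace_fin
    rw [hwpq, hpj j hj, zero_add]
    exact (PiLp.norm_apply_le q j).trans (hqr.trans (by gcongr))

/-- The box that contains `c` does not depend on `t`, so that only the number of its translates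
along the axis grows. -/
theorem exists_nsmul_single_add_of_mem_latticeBox_single {t r : ℝ} (ht : 0 ≤ t) {w : Fin d → ℤ}
    (hw : w ∈ latticeBox b b' t r) :
    ∃ s < 2 * ⌈t⌉₊ + 1, ∃ c ∈ Finset.Icc (fun _ : Fin d => -⌈|r| * d⌉) (fun _ => ⌈|r| * d⌉),
      w = -(⌈t⌉₊ • Pi.single i 1) + s • Pi.single i 1 + c := by
  obtain ⟨hwi, hwj⟩ := abs_apply_le_of_mem_latticeBox_single b b' hw
  have hwi : |w i| ≤ ⌈t⌉₊ := by
    exact_mod_cast (hwi.trans_eq (abs_of_nonneg ht)).trans (Nat.le_ceil t)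
  have hwj : ∀ j ≠ i, |w j| ≤ ⌈|r| * d⌉ := fun j hj => by
    exact_mod_cast (hwj j hj).trans (Int.le_ceil _)
  have hc : ∀ j, |Function.update w i 0 j| ≤ ⌈|r| * d⌉ := fun j => by
    rcases eq_or_ne j i with rfl | hj
    · rw [Function.update_self, abs_zero]
      positivity
    · rw [Function.update_of_ne hj]
      exact hwj j hj
  obtain ⟨hlower, hupper⟩ := abs_le.mp hwi
  refine ⟨(w i + ⌈t⌉₊).toNat, by omega, Function.update w i 0,
    Finset.mem_Icc.mpr ⟨fun j => (abs_le.mp (hc j)).1, fun j => (abs_le.mp (hc j)).2⟩, ?_⟩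
  ext j
  rcases eq_or_ne j i with rfl | hj
  · simp
    omega
  · simp [hj]

end LatticeBox

/-! ### Directional entropy -/

section Directional

variable {d : ℕ} {X : Type*} [MeasurableSpace X] {μ : Measure X} [IsProbabilityMeasure μ]
  [AddAction (Fin d → ℤ) X] [MeasurableConstVAdd (Fin d → ℤ) X]

theorem measurable_joinPartition {L : Type*} [MeasurableSpace L] {P : X → L} (hP : Measurable P)
    (F : Finset (Fin d → ℤ)) : Measurable (joinPartition F P) :=
  measurable_pi_lambda _ fun w => hP.comp (measurable_const_vadd (w : Fin d → ℤ))

variable [VAddInvariantMeasure (Fin d → ℤ) X μ]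

theorem partitionEntropy_joinPartition_le_itinerary {L : Type*} [Fintype L] [MeasurableSpace L]
    [MeasurableSingletonClass L] {P : X → L} (hP : Measurable P) {K C : Finset (Fin d → ℤ)}
    {u e : Fin d → ℤ} {N : ℕ} (hK : ∀ w ∈ K, ∃ s < N, ∃ c ∈ C, w = u + s • e + c) :
    partitionEntropy μ (joinPartition K P) ≤
      partitionEntropy μ (itinerary (fun x => e +ᵥ x) (joinPartition C P) N) := by
  choose s hs c hc hw using hK
  have hI := measurable_itinerary (measurable_const_vadd e) (measurable_joinPartition hP C) N
  rw [← partitionEntropy_comp_measurePreserving (measurePreserving_vadd u μ) hI]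
  refine partitionEntropy_le_of_forall_eq (hI.comp (measurable_const_vadd u))
    (fun f (w : K) => f ⟨s w w.2, hs w w.2⟩ ⟨c w w.2, hc w w.2⟩) fun x => funext fun w => ?_
  have hshift : (w : Fin d → ℤ) +ᵥ x =
      c w w.2 +ᵥ (fun y => e +ᵥ y)^[s w w.2] (u +ᵥ x) := by
    rw [vadd_iterate, vadd_vadd, vadd_vadd]
    exact congrArg (· +ᵥ x) ((hw w w.2).trans (by abel))
  exact congrArg P hshift

theorem HasZeroEntropy.tendsto_partitionEntropy_latticeBox_div {i : Fin d}
    (h : HasZeroEntropy μ fun x : X => (Pi.single i 1 : Fin d → ℤ) +ᵥ x)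
    (b : OrthonormalBasis (Fin (Module.finrank ℝ
      (Submodule.span ℝ {EuclideanSpace.single i (1 : ℝ)}))) ℝ
      (Submodule.span ℝ {EuclideanSpace.single i (1 : ℝ)}))
    (b' : OrthonormalBasis (Fin (Module.finrank ℝ
      (Submodule.span ℝ {EuclideanSpace.single i (1 : ℝ)})ᗮ)) ℝ
      (Submodule.span ℝ {EuclideanSpace.single i (1 : ℝ)})ᗮ)
    {L : Type} [Fintype L] [MeasurableSpace L] [MeasurableSingletonClass L] {P : X → L}
    (hP : Measurable P) (r : ℝ) :
    Tendsto (fun t => partitionEntropy μ (joinPartition (latticeBox b b' t r) P) / t) atTop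
      (𝓝 0) := by
  have hlength : Tendsto (fun t : ℝ => 2 * ⌈t⌉₊ + 1) atTop atTop :=
    tendsto_atTop_mono (fun t => by omega) tendsto_nat_ceil_atTop
  have hlinear : (fun t : ℝ => ((2 * ⌈t⌉₊ + 1 : ℕ) : ℝ)) =O[atTop] fun t => t := by
    refine IsBigO.of_bound 5 ?_
    filter_upwards [eventually_ge_atTop 1] with t ht
    rw [Real.norm_natCast, Real.norm_of_nonneg (zero_le_one.trans ht)]
    push_cast
    linarith [Nat.ceil_lt_add_one (zero_le_one.trans ht)]
  have hnames := ((h (measurable_joinPartition hP (Finset.Icc (fun _ : Fin d => -⌈|r| * d⌉)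
    fun _ => ⌈|r| * d⌉))).comp_tendsto hlength).trans_isBigO hlinear
  refine (IsBigO.trans_isLittleO (.of_norm_eventuallyLE ?_) hnames).tendsto_div_nhds_zero
  filter_upwards [eventually_ge_atTop 0] with t ht
  rw [Real.norm_of_nonneg (partitionEntropy_nonneg _)]
  exact partitionEntropy_joinPartition_le_itinerary hP fun w hw =>
    exists_nsmul_single_add_of_mem_latticeBox_single b b' ht hw

theorem HasZeroEntropy.directionalEntropy_span_single_eq_zero {i : Fin d}
    (h : HasZeroEntropy μ fun x : X => (Pi.single i 1 : Fin d → ℤ) +ᵥ x) :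
    directionalEntropy μ (Submodule.span ℝ {EuclideanSpace.single i (1 : ℝ)}) = 0 := by
  simp only [directionalEntropy, ENNReal.iSup_eq_zero]
  intro b b' N P hP r _
  have hlim := ENNReal.tendsto_ofReal (h.tendsto_partitionEntropy_latticeBox_div b b' hP r)
  rw [ENNReal.ofReal_zero] at hlim
  rw [directionalEntropyAt, finrank_span_singleton (by simp)]
  simpa only [pow_one] using hlim.limsup_eq

end Directional

end RankOne

theorem theorem4p1_general {d : ℕ} (hd : 1 ≤ d) {X : Type*} [MeasurableSpace X]
    (μ : MeasureTheory.Measure X) [MeasureTheory.IsProbabilityMeasure μ]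
    [AddAction (Fin d → ℤ) X] [MeasurableConstVAdd (Fin d → ℤ) X]
    [MeasureTheory.VAddInvariantMeasure (Fin d → ℤ) X μ] {m n : ℕ → Fin d → ℤ}
    (hmn : ∀ k, m k ≤ n k) (hR : RankOne.IsRankOne μ fun k => Finset.Icc (m k) (n k)) :
    (∃ V : Submodule ℝ (EuclideanSpace ℝ (Fin d)),
      Module.finrank ℝ V = 1 ∧ RankOne.directionalEntropy μ V = 0) ∧
    ∀ i : Fin d,
      (∃ᶠ k in Filter.atTop, ∀ j : Fin d, n k j - m k j ≤ n k i - m k i) →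
      RankOne.directionalEntropy μ
        (Submodule.span ℝ {EuclideanSpace.single i (1 : ℝ)}) = 0 := by
  have haxis : ∀ i : Fin d, (∃ᶠ k in atTop, ∀ j, n k j - m k j ≤ n k i - m k i) →
      RankOne.directionalEntropy μ (Submodule.span ℝ {EuclideanSpace.single i (1 : ℝ)}) = 0 :=
    fun i hi =>
      (hR.hasZeroEntropy_of_frequently_longest_side hmn hi).directionalEntropy_span_single_eq_zero
  have : Nonempty (Fin d) := ⟨⟨0, hd⟩⟩
  have hmax : ∃ᶠ k in atTop, ∃ i : Fin d, ∀ j, n k j - m k j ≤ n k i - m k i :=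
    (Eventually.of_forall fun k => Finite.exists_max fun j => n k j - m k j).frequently
  obtain ⟨i, hi⟩ := frequently_exists.mp hmax
  exact ⟨⟨_, finrank_span_singleton (by simp), haxis i hi⟩, haxis⟩

theorem theorem4p1 {d : ℕ} (hd : 1 ≤ d) {X : Type*} [MeasurableSpace X]
    (μ : MeasureTheory.Measure X) [MeasureTheory.IsProbabilityMeasure μ]
    (hX : RankOne.IsLebesgueSpace μ)
    [AddAction (Fin d → ℤ) X] [MeasurableConstVAdd (Fin d → ℤ) X]
    [MeasureTheory.VAddInvariantMeasure (Fin d → ℤ) X μ]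
    (hfree : RankOne.IsFree d μ) (hT : RankOne.IsRectangularRankOne d μ) :
    (∃ V : Submodule ℝ (EuclideanSpace ℝ (Fin d)),
      Module.finrank ℝ V = 1 ∧ RankOne.directionalEntropy μ V = 0) ∧
    ∀ m n : ℕ → Fin d → ℤ, (∀ k, m k ≤ n k) →
      RankOne.IsFolner (fun k => Finset.Icc (m k) (n k)) →
      RankOne.IsRankOne μ (fun k => Finset.Icc (m k) (n k)) →
      ∀ i : Fin d,
        (∃ᶠ k in Filter.atTop, ∀ j : Fin d, n k j - m k j ≤ n k i - m k i) →
        RankOne.directionalEntropy μ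
          (Submodule.span ℝ {EuclideanSpace.single i (1 : ℝ)}) = 0 := by
  obtain ⟨m, n, hmn, -, hR⟩ := hT
  exact ⟨(theorem4p1_general hd μ hmn hR).1,
    fun m n hmn _ hR => (theorem4p1_general hd μ hmn hR).2⟩
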